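/- Let $k$ be a field and $\Lambda = k[x]/(x^4)$. Let $\operatorname{mono}(1\to 2\to 3\to 4,\Lambda)$ be the full subcategory of the category of representations of the quiver $1\to 2\to 3\to 4$ in $\Lambda$-modules whose objects are the sequences $M_1\xrightarrow{h_1} M_2\xrightarrow{h_2} M_3\xrightarrow{h_3} M_4$ of finitely generated $\Lambda$-modules with $h_1,h_2,h_3$ injective $\Lambda$-linear maps. Let $\Gamma$ be the quiver with one vertex and two loops, and let $\operatorname{rep}\Gamma$ be the category of its finite-dimensional representations over $k$. Then $\operatorname{mono}(1\to 2\to 3\to 4,\Lambda)$ is wild in the sense of Drozd, i.e. there exists a $k$-linear faithful exact functor $$F\colon \operatorname{rep}\Gamma\longrightarrow \operatorname{mono}(1\to 2\to 3\to 4,\Lambda)$$ that preserves indecomposables (if $V$ is indecomposable, then so is $F(V)$) and reflects isomorphisms (if $F(V)\cong F(W)$, then $V\cong W$). Here exact means that $F$ sends short exact sequences of representations of $\Gamma$ to sequences that are exact in the abelian category of representations of $1\to 2\to 3\to 4$ over $\Lambda$. -/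

import Mathlib

open CategoryTheory CategoryTheory.Limits
open scoped Polynomial DirectSum

universe u

/-- The vertex set of the linearly oriented quiver `1 → 2 → ⋯ → m`; the vertex called `i + 1`
on paper is the element `i` of `Fin m`. -/
def LinearQuiver (m : ℕ) : Type := Fin m

/-- There is exactly one arrow from each vertex to the next one, and no other arrow. -/
instance LinearQuiver.instQuiver (m : ℕ) : Quiver.{0} (LinearQuiver m) :=
  ⟨fun i j => PLift ((Fin.val (n := m) i) + 1 = (Fin.val (n := m) j))⟩

/-- The quiver with one vertex and two loops. -/
abbrev TwoLoopQuiver : Type := Quiver.SingleObj (Fin 2)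

/-- `rep(Q, Mod Λ)`: the representations of the quiver `Q` by `Λ`-modules. A functor on the path
category of `Q` is the same thing as a family of modules indexed by the vertices with a linear map
for each arrow, and a natural transformation is a family of linear maps compatible with the
arrows. -/
abbrev QuiverRep (Q : Type) [Quiver.{0} Q] (Λ : Type u) [Ring Λ] :=
  Paths Q ⥤ ModuleCat.{u} Λ

namespace QuiverRep

variable {Q : Type} [Quiver.{0} Q] {Λ : Type u} [Ring Λ]

/-- The module `M_i` of a representation at the vertex `i`. -/
abbrev at_ (M : QuiverRep Q Λ) (i : Q) : ModuleCat.{u} Λ := M.obj ((Paths.of Q).obj i)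

/-- The linear map `h_α : M_j → M_i` of a representation along the arrow `α : j → i`. -/
abbrev along (M : QuiverRep Q Λ) {j i : Q} (α : j ⟶ i) : M.at_ j →ₗ[Λ] M.at_ i :=
  (M.map ((Paths.of Q).map α)).hom

open Classical in
/-- The map `h_{i,in} : ⨁_{α, t(α) = i} M_{s(α)} → M_i` with components `h_α`. -/
noncomputable def incoming (M : QuiverRep Q Λ) (i : Q) :
    (⨁ α : (Σ j : Q, (j ⟶ i)), M.at_ α.1) →ₗ[Λ] M.at_ i :=
  DirectSum.toModule Λ (Σ j : Q, (j ⟶ i)) (M.at_ i) (fun α => M.along α.2)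

end QuiverRep

/-- `rep(Q, mod Λ)`: the representations with finitely generated modules at all vertices, as a full
subcategory of `rep(Q, Mod Λ)`. If `Λ` is a field these are the finite-dimensional ones
(for `Q` with finitely many vertices). -/
def repFg (Q : Type) [Quiver.{0} Q] (Λ : Type u) [Ring Λ] : ObjectProperty (QuiverRep Q Λ) :=
  fun M => ∀ i : Q, Module.Finite Λ (M.at_ i)

/-- The monomorphism category `mono(Q, Λ)`, as a full subcategory of `rep(Q, Mod Λ)`: the finitely
generated representations for which all the maps `h_{i,in}` are injective. -/
def monoCat (Q : Type) [Quiver.{0} Q] (Λ : Type u) [Ring Λ] : ObjectProperty (QuiverRep Q Λ) :=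
  fun M => repFg Q Λ M ∧ ∀ i : Q, Function.Injective (M.incoming i)

/-- An object `X` is indecomposable if it is nonzero, and if `X ≅ Y ⊕ Z` implies `Y = 0` or
`Z = 0`. Here `Y ⊕ Z` is any biproduct of `Y` and `Z`; it is not assumed that the category has all
biproducts. -/
def IsIndecomposable {C : Type*} [Category* C] [HasZeroMorphisms C] (X : C) : Prop :=
  ¬ IsZero X ∧
    ∀ (Y Z : C) (b : BinaryBicone Y Z), Nonempty b.IsBilimit → Nonempty (X ≅ b.pt) →
      IsZero Y ∨ IsZero Z

/-- An additive functor between full subcategories of abelian categories is exact if it sends the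
sequences `0 → X → Y → Z → 0` that are exact in the first ambient category to sequences that are
exact in the second. -/
def IsExactBetween {A B : Type*} [Category* A] [Category* B] [Abelian A] [Abelian B]
    {P : ObjectProperty A} {R : ObjectProperty B} (F : P.FullSubcategory ⥤ R.FullSubcategory)
    [F.Additive] : Prop :=
  ∀ S : ShortComplex P.FullSubcategory,
    (S.map P.ι).ShortExact → ((S.map F).map R.ι).ShortExact

/-- Wildness in the sense of Drozd, over a field `k`, of a full subcategory `R` of a `k`-linear
abelian category: there is a faithful exact (`k`-linear) functor to `R` from the category of
finite-dimensional representations of the quiver with one vertex and two loops that preserves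
indecomposables and reflects isomorphisms, i.e. sends non-isomorphic objects to non-isomorphic
ones. (That a morphism is invertible if its image is invertible follows from faithfulness.) -/
def IsWild (k : Type u) [Field k] {B : Type*} [Category* B] [Abelian B] [Linear k B]
    (R : ObjectProperty B) : Prop :=
  ∃ (F : (repFg TwoLoopQuiver k).FullSubcategory ⥤ R.FullSubcategory) (_ : F.Additive),
    F.Linear k ∧ F.Faithful ∧ IsExactBetween F ∧
      (∀ X, IsIndecomposable X → IsIndecomposable (F.obj X)) ∧
      (∀ X Y, Nonempty (F.obj X ≅ F.obj Y) → Nonempty (X ≅ Y))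

/-- The algebra `k[x]/(x^n)`. -/
abbrev TruncatedPolynomial (k : Type u) [Field k] (n : ℕ) : Type u :=
  k[X] ⧸ Ideal.span {(Polynomial.X ^ n : k[X])}

/-! A pair of operators `A`, `B` on `V` can be encoded by five subspaces of `V⁴` forming the poset
`(1, 1, 1, 2)`: `V² ⊕ 0`, `0 ⊕ V²`, the diagonal of all `(a, b, a, b)`, and a chain `K ⊂ K'`, where
`K` consists of the `(v, 0, A v, v)` and `K'` is spanned by `K` and the `(0, b, B b, 0)`.

The last module is graded in degrees `-1` to `2`, with `V⁴` in degree `0`, and `x` raises degree by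
one. The diagonal is the image from degree `-1`, and `K` is the kernel of the map to degree `2`. The
third vertex marks `V² ⊕ 0`, the second `0 ⊕ V²`, and the first marks `K' / K ≅ V`.

Morphisms need not be graded, but their degree `0` blocks respect the five subspaces. By
`poset_rigidity` such a block is diagonal, given by the component `p` at the first vertex, and `p`
commutes with the operators (`IsChainMap.rigidity`). So restriction to the first vertex is a
functorial retraction of `wildFunctor` on morphisms; faithfulness and reflection of isomorphisms
follow.

A morphism restricting to zero strictly raises degree at the last vertex, so it is zero if it is
idempotent (`IsChainMap.eq_zero_of_idempotent`). Hence no nontrivial decomposition of the image of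
an indecomposable survives restriction (`isIndecomposable_map`). -/

namespace WildMono

/-! ### The graded spaces, their nilpotent operators and the inclusions -/

section Maps

variable {k : Type u} [Field k]

/-- The space at the second vertex, with summands in the degrees `1` and `2`. -/
abbrev Space₂ (V : Type u) : Type u := (V × V) × (V × V × V)

/-- The space at the third vertex, with summands in the degrees `0`, `1` and `2`. -/
abbrev Space₃ (V : Type u) : Type u := (V × V) × (V × V × V × V) × (V × V × V)

/-- The space at the last vertex, with summands in the degrees `-1`, `0`, `1` and `2`. -/
abbrev Space₄ (V : Type u) : Type u :=
  (V × V) × (V × V × V × V) × (V × V × V × V) × (V × V × V)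

variable {V V' : Type u} [AddCommGroup V] [Module k V] [AddCommGroup V'] [Module k V']

/-- The quotient map from `V⁴` by the subspace of all `(v, 0, A v, v)`. -/
def quotMap (A : V →ₗ[k] V) : V × V × V × V →ₗ[k] V × V × V where
  toFun w := (w.2.1, w.2.2.1 - A w.1, w.2.2.2 - w.1)
  map_add' w w' := by ext <;> simp <;> abel
  map_smul' c w := by ext <;> simp [smul_sub]

/-- The nilpotent operator at the second vertex. -/
def shift₂ : Space₂ V →ₗ[k] Space₂ V where
  toFun m := (0, (0, m.1.1, m.1.2))
  map_add' _ _ := by simp [Prod.ext_iff]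
  map_smul' _ _ := by simp [Prod.ext_iff]

/-- The nilpotent operator at the third vertex. -/
def shift₃ (A : V →ₗ[k] V) : Space₃ V →ₗ[k] Space₃ V where
  toFun m := (0, (m.1.1, m.1.2, 0, 0), quotMap A m.2.1)
  map_add' _ _ := by simp
  map_smul' _ _ := by simp

/-- The nilpotent operator at the last vertex. -/
def shift₄ (A : V →ₗ[k] V) : Space₄ V →ₗ[k] Space₄ V where
  toFun m := (0, (m.1.1, m.1.2, m.1.1, m.1.2), m.2.1, quotMap A m.2.2.1)
  map_add' _ _ := by simp [Prod.ext_iff]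
  map_smul' _ _ := by simp [Prod.ext_iff]

/-- The inclusion of the first into the second space. -/
def incl₁ (B : V →ₗ[k] V) : V →ₗ[k] Space₂ V where
  toFun v := (0, (v, B v, 0))
  map_add' _ _ := by simp
  map_smul' _ _ := by simp

/-- The inclusion of the second into the third space. -/
def incl₂ : Space₂ V →ₗ[k] Space₃ V where
  toFun m := (0, (0, 0, m.1.1, m.1.2), m.2)
  map_add' _ _ := by simp [Prod.ext_iff]
  map_smul' _ _ := by simp [Prod.ext_iff]

/-- The inclusion of the third into the last space. -/
def incl₃ : Space₃ V →ₗ[k] Space₄ V where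
  toFun m := (0, (m.1.1, m.1.2, 0, 0), m.2.1, m.2.2)
  map_add' _ _ := by simp [Prod.ext_iff]
  map_smul' _ _ := by simp [Prod.ext_iff]

@[simp] lemma quotMap_apply (A : V →ₗ[k] V) (w : V × V × V × V) :
    quotMap A w = (w.2.1, w.2.2.1 - A w.1, w.2.2.2 - w.1) := rfl
@[simp] lemma shift₂_apply (m : Space₂ V) :
    shift₂ (k := k) m = (0, (0, m.1.1, m.1.2)) := rfl
@[simp] lemma shift₃_apply (A : V →ₗ[k] V) (m : Space₃ V) :
    shift₃ A m = (0, (m.1.1, m.1.2, 0, 0), quotMap A m.2.1) := rfl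
@[simp] lemma shift₄_apply (A : V →ₗ[k] V) (m : Space₄ V) :
    shift₄ A m = (0, (m.1.1, m.1.2, m.1.1, m.1.2), m.2.1, quotMap A m.2.2.1) := rfl
@[simp] lemma incl₁_apply (B : V →ₗ[k] V) (v : V) : incl₁ B v = (0, (v, B v, 0)) := rfl
@[simp] lemma incl₂_apply (m : Space₂ V) :
    incl₂ (k := k) m = (0, (0, 0, m.1.1, m.1.2), m.2) := rfl
@[simp] lemma incl₃_apply (m : Space₃ V) :
    incl₃ (k := k) m = (0, (m.1.1, m.1.2, 0, 0), m.2.1, m.2.2) := rfl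

lemma shift₂_pow : (shift₂ : Module.End k (Space₂ V)) ^ 4 = 0 := by
  refine LinearMap.ext fun m => ?_
  simp [pow_succ]

lemma shift₃_pow (A : V →ₗ[k] V) : (shift₃ A : Module.End k (Space₃ V)) ^ 4 = 0 := by
  refine LinearMap.ext fun m => ?_
  simp [pow_succ]

lemma shift₄_pow (A : V →ₗ[k] V) : (shift₄ A : Module.End k (Space₄ V)) ^ 4 = 0 := by
  refine LinearMap.ext fun m => ?_
  simp [pow_succ]

lemma incl₁_shift (B : V →ₗ[k] V) (v : V) :
    incl₁ B ((0 : V →ₗ[k] V) v) = shift₂ (k := k) (incl₁ B v) := by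
  simp

lemma incl₂_shift (A : V →ₗ[k] V) (m : Space₂ V) :
    incl₂ (k := k) (shift₂ (k := k) m) = shift₃ A (incl₂ (k := k) m) := by
  simp

lemma incl₃_shift (A : V →ₗ[k] V) (m : Space₃ V) :
    incl₃ (k := k) (shift₃ A m) = shift₄ A (incl₃ (k := k) m) := by
  simp

lemma incl₁_injective (B : V →ₗ[k] V) : Function.Injective (incl₁ B) := by
  intro v w h
  simp at h
  exact h.1

lemma incl₂_injective : Function.Injective (incl₂ : Space₂ V →ₗ[k] Space₃ V) := by
  rintro ⟨⟨a, b⟩, t⟩ ⟨⟨a', b'⟩, t'⟩ h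
  simpa [and_assoc] using h

lemma incl₃_injective : Function.Injective (incl₃ : Space₃ V →ₗ[k] Space₄ V) := by
  rintro ⟨⟨a, b⟩, t⟩ ⟨⟨a', b'⟩, t'⟩ h
  simpa [and_assoc, Prod.ext_iff] using h

/-- The diagonal extension of a linear map to the second spaces. -/
abbrev diag₂ (h : V →ₗ[k] V') : Space₂ V →ₗ[k] Space₂ V' :=
  (h.prodMap h).prodMap (h.prodMap (h.prodMap h))

/-- The diagonal extension of a linear map to the third spaces. -/
abbrev diag₃ (h : V →ₗ[k] V') : Space₃ V →ₗ[k] Space₃ V' :=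
  (h.prodMap h).prodMap
    ((h.prodMap (h.prodMap (h.prodMap h))).prodMap (h.prodMap (h.prodMap h)))

/-- The diagonal extension of a linear map to the last spaces. -/
abbrev diag₄ (h : V →ₗ[k] V') : Space₄ V →ₗ[k] Space₄ V' :=
  (h.prodMap h).prodMap ((h.prodMap (h.prodMap (h.prodMap h))).prodMap
    ((h.prodMap (h.prodMap (h.prodMap h))).prodMap (h.prodMap (h.prodMap h))))

lemma exact_prodMap {X X' X'' Y Y' Y'' : Type u}
    [AddCommGroup X] [Module k X] [AddCommGroup X'] [Module k X'] [AddCommGroup X''] [Module k X'']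
    [AddCommGroup Y] [Module k Y] [AddCommGroup Y'] [Module k Y'] [AddCommGroup Y''] [Module k Y'']
    {f : X →ₗ[k] X'} {g : X' →ₗ[k] X''} {f' : Y →ₗ[k] Y'} {g' : Y' →ₗ[k] Y''}
    (h : Function.Exact f g) (h' : Function.Exact f' g') :
    Function.Exact (f.prodMap f') (g.prodMap g') := by
  rintro ⟨y, y'⟩
  have := h y
  have := h' y'
  simp_all [Set.mem_range, Prod.ext_iff]

end Maps

/-! ### Rigidity of morphisms -/

section Rigidity

variable {k : Type u} [Field k] {V V' : Type u} [AddCommGroup V] [Module k V]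
  [AddCommGroup V'] [Module k V']

/-- A linear map between the ambient spaces of two representations of the poset `(1, 1, 1, 2)`
which maps the five subspaces into each other is diagonal. -/
lemma poset_rigidity {A B : V →ₗ[k] V} {A' B' : V' →ₗ[k] V'} (p : V → V')
    (β : V × V × V × V →ₗ[k] V' × V' × V' × V')
    (h₃ : ∀ a b, (β (a, b, 0, 0)).2.2 = 0)
    (h₂ : ∀ c d, (β (0, 0, c, d)).1 = 0 ∧ (β (0, 0, c, d)).2.1 = 0)
    (h₄ : ∀ a b, (β (a, b, a, b)).1 = (β (a, b, a, b)).2.2.1 ∧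
      (β (a, b, a, b)).2.1 = (β (a, b, a, b)).2.2.2)
    (h₁ : ∀ a, quotMap A' (β (a, 0, A a, a)) = 0)
    (h₁' : ∀ b, quotMap A' (β (0, b, B b, 0)) = (p b, B' (p b), 0)) :
    (∀ a b c d, β (a, b, c, d) = (p a, p b, p c, p d)) ∧
      (∀ v, p (A v) = A' (p v)) ∧ ∀ v, p (B v) = B' (p v) := by
  let ι₁ : V →ₗ[k] V × V × V × V := LinearMap.inl k V (V × V × V)
  let ι₂ : V →ₗ[k] V × V × V × V := LinearMap.inr k V (V × V × V) ∘ₗ LinearMap.inl k V (V × V)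
  let π₁ : V' × V' × V' × V' →ₗ[k] V' := LinearMap.fst k V' (V' × V' × V')
  let π₂ : V' × V' × V' × V' →ₗ[k] V' :=
    LinearMap.fst k V' (V' × V') ∘ₗ LinearMap.snd k V' (V' × V' × V')
  obtain ⟨f, hf⟩ : ∃ f : V →ₗ[k] V', f = π₁ ∘ₗ β ∘ₗ ι₁ := ⟨_, rfl⟩
  obtain ⟨f', hf'⟩ : ∃ f : V →ₗ[k] V', f = π₁ ∘ₗ β ∘ₗ ι₂ := ⟨_, rfl⟩
  obtain ⟨g, hg⟩ : ∃ g : V →ₗ[k] V', g = π₂ ∘ₗ β ∘ₗ ι₁ := ⟨_, rfl⟩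
  obtain ⟨g', hg'⟩ : ∃ g : V →ₗ[k] V', g = π₂ ∘ₗ β ∘ₗ ι₂ := ⟨_, rfl⟩
  have hleft : ∀ a b, β (a, b, 0, 0) = (f a + f' b, g a + g' b, 0, 0) := by
    intro a b
    have e : β (a, b, 0, 0) = β (a, 0, 0, 0) + β (0, b, 0, 0) := by
      rw [← map_add]
      simp
    have e' := h₃ a b
    subst hf hf' hg hg'
    refine Prod.ext ?_ (Prod.ext ?_ e')
    · rw [e]; rfl
    · rw [e]; rfl
  -- The two copies of `V²` make `β` block diagonal and the diagonal makes its blocks equal: `β = M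
  -- ⊕ M` with `M` having rows `(f, f')` and `(g, g')`.
  have hβ : ∀ a b c d, β (a, b, c, d) = (f a + f' b, g a + g' b, f c + f' d, g c + g' d) := by
    intro a b c d
    have hsplit : ∀ a b, β (a, b, c, d) = β (a, b, 0, 0) + β (0, 0, c, d) := by
      intro a b
      rw [← map_add]
      simp
    have e := h₄ c d
    have e₂ := h₂ c d
    rw [hsplit, hleft] at e ⊢
    generalize β (0, 0, c, d) = w at *
    obtain ⟨w₁, w₂, w₃, w₄⟩ := w
    obtain ⟨rfl, rfl⟩ := e₂
    simpa [eq_comm] using e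
  simp only [hβ, quotMap_apply, map_zero, zero_add, add_zero, Prod.mk.injEq, Prod.mk_eq_zero]
    at h₁ h₁'
  -- The vectors `(a, 0, A a, a)` give `g = 0` and `f = g'`; the vectors `(0, b, B b, 0)` give `g' =
  -- p` and `f' = 0`. So `M` is scalar, equal to `p`.
  have hg0 : ∀ a, g a = 0 := fun a => (h₁ a).1
  have hg'p : ∀ b, g' b = p b := fun b => (h₁' b).1
  have hf'0 : ∀ b, f' b = 0 := by
    intro b
    simpa [hg0] using (h₁' b).2.2
  have hfp : ∀ a, f a = p a := by
    intro a
    have := (h₁ a).2.2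
    rw [hg0, zero_add, sub_eq_zero, hg'p] at this
    exact this.symm
  refine ⟨fun a b c d => ?_, fun v => ?_, fun v => ?_⟩
  · simp [hβ, hf'0, hg0, hfp, hg'p]
  · simpa [hf'0, hfp, sub_eq_zero] using (h₁ v).2.1
  · simpa [hf'0, hfp] using (h₁' v).2.1

/-- The part of degree `0` of a morphism on the summand of degree `0` of the last space. -/
def middleBlock (f : Space₄ V →ₗ[k] Space₄ V') : V × V × V × V →ₗ[k] V' × V' × V' × V' :=
  (LinearMap.fst k _ _ ∘ₗ LinearMap.snd k _ _) ∘ₗ f ∘ₗ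
    (LinearMap.inr k _ _ ∘ₗ LinearMap.inl k _ _)

lemma middleBlock_apply (f : Space₄ V →ₗ[k] Space₄ V') (w : V × V × V × V) :
    middleBlock f w = (f (0, w, 0, 0)).2.1 := rfl

/-- The compatibility of a family of linear maps between the four spaces with the nilpotent
operators and the inclusions. -/
structure IsChainMap (A B : V →ₗ[k] V) (A' B' : V' →ₗ[k] V') (p : V →ₗ[k] V')
    (f₂ : Space₂ V →ₗ[k] Space₂ V') (f₃ : Space₃ V →ₗ[k] Space₃ V')
    (f₄ : Space₄ V →ₗ[k] Space₄ V') : Prop where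
  -- The last vertex suffices: the inclusions are injective and intertwine the operators, so
  -- compatibility at the other vertices follows.
  shift : ∀ m, f₄ (shift₄ A m) = shift₄ A' (f₄ m)
  incl₁ : ∀ v, f₂ (incl₁ B v) = incl₁ B' (p v)
  incl₂ : ∀ m, f₃ (incl₂ (k := k) m) = incl₂ (k := k) (f₂ m)
  incl₃ : ∀ m, f₄ (incl₃ (k := k) m) = incl₃ (k := k) (f₃ m)

namespace IsChainMap

variable {A B : V →ₗ[k] V} {A' B' : V' →ₗ[k] V'} {p : V →ₗ[k] V'}
  {f₂ : Space₂ V →ₗ[k] Space₂ V'} {f₃ : Space₃ V →ₗ[k] Space₃ V'}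
  {f₄ : Space₄ V →ₗ[k] Space₄ V'}

lemma map_diagonal (h : IsChainMap A B A' B' p f₂ f₃ f₄) (a b : V) :
    f₄ (0, (a, b, a, b), 0, 0) = shift₄ A' (f₄ ((a, b), 0, 0, 0)) := by
  rw [← h.shift, shift₄_apply]
  simp only [map_zero]

lemma map_degree_one (h : IsChainMap A B A' B' p f₂ f₃ f₄) (w : V × V × V × V) :
    f₄ (0, 0, w, 0) = shift₄ A' (f₄ (0, w, 0, 0)) := by
  rw [← h.shift, shift₄_apply]
  simp only [Prod.fst_zero, Prod.snd_zero, map_zero]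
  rfl

/-- Degree `2` is reached from degree `0` by applying the operator twice, so values there are
determined by those in degree `0`. -/
lemma map_degree_two (h : IsChainMap A B A' B' p f₂ f₃ f₄) (w : V × V × V × V) :
    f₄ (0, 0, 0, quotMap A w) = shift₄ A' (shift₄ A' (f₄ (0, w, 0, 0))) := by
  rw [← h.map_degree_one, ← h.shift, shift₄_apply]
  simp only [Prod.fst_zero, Prod.snd_zero]
  rfl

/-- The cube of the operator kills degree `0` but is injective on degree `-1`: `quotMap` sends `(a,
b, a, b)` to a vector with entries `b` and `b - a`, so the diagonal meets its kernel trivially. -/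
lemma fst_middle (h : IsChainMap A B A' B' p f₂ f₃ f₄) (w : V × V × V × V) :
    (f₄ (0, w, 0, 0)).1 = 0 := by
  have e : shift₄ A' (shift₄ A' (shift₄ A' (f₄ (0, w, 0, 0)))) = 0 := by
    rw [← h.map_degree_two, ← h.shift, shift₄_apply]
    simp only [Prod.fst_zero, Prod.snd_zero, map_zero]
    exact map_zero f₄
  generalize f₄ (0, w, 0, 0) = m at e
  obtain ⟨⟨a, b⟩, m⟩ := m
  simp only [shift₄_apply, quotMap_apply, Prod.mk_eq_zero] at e
  obtain ⟨-, -, -, rfl, -, e⟩ := e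
  simpa using e

/-- The second vertex shows `0 ⊕ V²` only in degree `1`; commuting with the operator moves this
condition to degree `0`. The conditions on the chain of two are read off in degree `2`, through
`quotMap`. -/
lemma rigidity (h : IsChainMap A B A' B' p f₂ f₃ f₄) :
    (∀ a b c d, middleBlock f₄ (a, b, c, d) = (p a, p b, p c, p d)) ∧
      (∀ v, p (A v) = A' (p v)) ∧ ∀ v, p (B v) = B' (p v) := by
  refine poset_rigidity p (middleBlock f₄) ?_ ?_ ?_ ?_ ?_
  · intro a b
    have e : f₄ (0, (a, b, 0, 0), 0, 0) = _ := h.incl₃ ((a, b), 0, 0)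
    rw [middleBlock_apply, e]
    rfl
  · intro c d
    have e : f₄ (0, 0, (0, 0, c, d), 0) = _ :=
      h.incl₃ (WildMono.incl₂ (k := k) ((c, d), 0))
    rw [h.incl₂, h.map_degree_one] at e
    have e' := congrArg (fun m => m.2.2.1) e
    simp only [shift₄_apply, incl₃_apply, incl₂_apply] at e'
    rw [middleBlock_apply, e']
    exact ⟨rfl, rfl⟩
  · intro a b
    rw [middleBlock_apply, h.map_diagonal]
    exact ⟨rfl, rfl⟩
  · intro a
    have e := h.map_degree_two (a, 0, A a, a)
    have e' : quotMap A (a, 0, A a, a) = 0 := by simp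
    rw [e'] at e
    have e₀ : f₄ (0, 0, 0, 0) = 0 := map_zero f₄
    exact (congrArg (fun m => m.2.2.2) (e.symm.trans e₀) :)
  · intro b
    have e := h.map_degree_two (0, b, B b, 0)
    have e' : quotMap A (0, b, B b, 0) = (b, B b, 0) := by simp
    have e₁ : f₄ (0, 0, 0, (b, B b, 0)) = _ :=
      h.incl₃ (WildMono.incl₂ (k := k) (WildMono.incl₁ B b))
    rw [h.incl₂, h.incl₁] at e₁
    rw [e'] at e
    exact (congrArg (fun m => m.2.2.2) (e.symm.trans e₁) :)

end IsChainMap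

/-- An idempotent endomorphism which vanishes at the first vertex is zero. -/
lemma IsChainMap.eq_zero_of_idempotent {A B : V →ₗ[k] V} {f₂ : Space₂ V →ₗ[k] Space₂ V}
    {f₃ : Space₃ V →ₗ[k] Space₃ V} {f₄ : Space₄ V →ₗ[k] Space₄ V}
    (h : IsChainMap A B A B 0 f₂ f₃ f₄) (hf : ∀ m, f₄ (f₄ m) = f₄ m) : f₄ = 0 := by
  have h0 : ∀ w, (f₄ (0, w, 0, 0)).2.1 = 0 := fun ⟨a, b, c, d⟩ => h.rigidity.1 a b c d
  have h1 : ∀ y, (f₄ (y, 0, 0, 0)).1 = 0 := by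
    rintro ⟨a, b⟩
    have e := h0 (a, b, a, b)
    rw [h.map_diagonal] at e
    simp only [shift₄_apply, Prod.mk_eq_zero] at e
    exact Prod.ext e.1 e.2.1
  have h2 : ∀ w, (f₄ (0, 0, w, 0)).1 = 0 ∧ (f₄ (0, 0, w, 0)).2.1 = 0 ∧
      (f₄ (0, 0, w, 0)).2.2.1 = 0 := by
    intro w
    rw [h.map_degree_one, shift₄_apply, h.fst_middle, h0]
    exact ⟨rfl, rfl, rfl⟩
  have h3 : ∀ t, f₄ (0, 0, 0, t) = 0 := by
    rintro ⟨a, b, c⟩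
    -- `(0, a, b, c)` is a preimage of `(a, b, c)` under `quotMap A`.
    have e := h.map_degree_two (0, a, b, c)
    have e' : quotMap A (0, a, b, c) = (a, b, c) := by simp
    rw [e', shift₄_apply, shift₄_apply, h.fst_middle, h0] at e
    rw [e]
    simp only [Prod.fst_zero, Prod.snd_zero]
    exact congrArg (fun t => (0, 0, 0, t)) (map_zero (quotMap A))
  -- By now `f₄` strictly raises degree, so the components of a fixed vector vanish one degree at a
  -- time, from the lowest up.
  have hfix : ∀ m, f₄ m = m → m = 0 := by
    rintro ⟨y, w, z, t⟩ hm
    have hadd : f₄ (y, w, z, t) =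
        f₄ (y, 0, 0, 0) + f₄ (0, w, 0, 0) + f₄ (0, 0, z, 0) + f₄ (0, 0, 0, t) := by
      simp only [← map_add, Prod.mk_add_mk, add_zero, zero_add]
    have hy : y = 0 := by
      have e := congrArg Prod.fst (hadd.symm.trans hm)
      simpa only [Prod.fst_add, h1, h.fst_middle, (h2 z).1, h3, Prod.fst_zero, add_zero,
        eq_comm] using e
    subst hy
    have e₀ : f₄ (0, 0, 0, 0) = 0 := map_zero f₄
    rw [e₀, zero_add, h3, add_zero] at hadd
    have hw : w = 0 := by
      have e := congrArg (fun m => m.2.1) (hadd.symm.trans hm)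
      simpa only [Prod.fst_add, Prod.snd_add, h0, (h2 z).2.1, add_zero, eq_comm] using e
    subst hw
    rw [e₀, zero_add] at hadd
    have hz : z = 0 := by
      have e := congrArg (fun m => m.2.2.1) (hadd.symm.trans hm)
      simpa only [(h2 z).2.2, eq_comm] using e
    subst hz
    rw [h3] at hm
    exact hm.symm
  exact LinearMap.ext fun m => hfix _ (hf m)

end Rigidity

/-! ### Modules over `k[x]/(x^n)` as vector spaces with a nilpotent operator -/

section ModuleOfEnd

variable {k : Type u} [Field k] {n : ℕ}

/-- The action of `k[x]/(x^n)` on a vector space through an operator `T` with `T ^ n = 0`. -/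
noncomputable def truncatedAction {E : Type u} [AddCommGroup E] [Module k E] (T : Module.End k E)
    (hT : T ^ n = 0) : TruncatedPolynomial k n →+* Module.End k E :=
  Ideal.Quotient.lift _ (Polynomial.aeval T).toRingHom (by
    intro a ha
    obtain ⟨b, rfl⟩ := Ideal.mem_span_singleton.1 ha
    simp [hT])

/-- The module over `k[x]/(x^n)` on which `x` acts through the operator `T`. -/
noncomputable def modOfEnd (E : Type u) [AddCommGroup E] [Module k E] (T : Module.End k E)
    (hT : T ^ n = 0) : ModuleCat.{u} (TruncatedPolynomial k n) :=
  letI := Module.compHom E (truncatedAction T hT)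
  ModuleCat.of _ E

variable {E E' : Type u} [AddCommGroup E] [Module k E] [AddCommGroup E'] [Module k E']
  {T : Module.End k E} {T' : Module.End k E'}
  {hT : T ^ n = 0} {hT' : T' ^ n = 0}

/-- The identification of the vector space with the underlying space of the module. -/
noncomputable def modOfEnd.equiv (T : Module.End k E) (hT : T ^ n = 0) :
    modOfEnd E T hT ≃+ E :=
  -- The identity, but named, so that the actions of `k` and of `k[x]/(x^n)` are kept on separate
  -- types.
  AddEquiv.refl E

lemma modOfEnd.equiv_mk_smul (q : k[X]) (m : modOfEnd E T hT) :
    modOfEnd.equiv T hT ((Ideal.Quotient.mk _ q : TruncatedPolynomial k n) • m) =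
      Polynomial.aeval T q (modOfEnd.equiv T hT m) :=
  rfl

lemma aeval_commute (f : E →ₗ[k] E') (hf : ∀ m, f (T m) = T' (f m)) (q : k[X]) (m : E) :
    f (Polynomial.aeval T q m) = Polynomial.aeval T' q (f m) := by
  induction q using Polynomial.induction_on generalizing m with
  | C a => simp
  | add p q hp hq => simp [hp, hq]
  | monomial i a h =>
    have := h (T m)
    rw [hf] at this
    simpa [pow_succ, ← mul_assoc] using this

lemma modOfEnd.map_smul_of_commute (f : E →ₗ[k] E') (hf : ∀ m, f (T m) = T' (f m))
    (r : TruncatedPolynomial k n) (m : modOfEnd E T hT) :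
    (modOfEnd.equiv T' hT').symm (f (modOfEnd.equiv T hT (r • m))) =
      r • (modOfEnd.equiv T' hT').symm (f (modOfEnd.equiv T hT m)) := by
  obtain ⟨q, rfl⟩ := Ideal.Quotient.mk_surjective r
  rw [AddEquiv.symm_apply_eq, modOfEnd.equiv_mk_smul, aeval_commute f hf,
    modOfEnd.equiv_mk_smul, AddEquiv.apply_symm_apply]

/-- A linear map which intertwines two operators, as a morphism of modules. -/
noncomputable def modOfEnd.ofLin (f : E →ₗ[k] E') (hf : ∀ m, f (T m) = T' (f m)) :
    modOfEnd E T hT ⟶ modOfEnd E' T' hT' :=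
  ModuleCat.ofHom (X := modOfEnd E T hT) (Y := modOfEnd E' T' hT')
    { toFun := fun m => (modOfEnd.equiv T' hT').symm (f (modOfEnd.equiv T hT m))
      map_add' := fun m m' => by simp
      map_smul' := modOfEnd.map_smul_of_commute f hf }

/-- The linear map underlying a morphism of modules. -/
noncomputable def modOfEnd.toLin (g : modOfEnd E T hT ⟶ modOfEnd E' T' hT') : E →ₗ[k] E' where
  toFun m := modOfEnd.equiv T' hT' (g.hom ((modOfEnd.equiv T hT).symm m))
  map_add' m m' := by simp
  map_smul' := by
    intro c m
    have e : (modOfEnd.equiv T hT).symm (c • m) =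
        (Ideal.Quotient.mk _ (Polynomial.C c) : TruncatedPolynomial k n) •
          (modOfEnd.equiv T hT).symm m := by
      rw [AddEquiv.symm_apply_eq, modOfEnd.equiv_mk_smul, Polynomial.aeval_C,
        AddEquiv.apply_symm_apply]
      rfl
    rw [e, map_smul, modOfEnd.equiv_mk_smul, Polynomial.aeval_C]
    rfl

lemma modOfEnd.toLin_smul (c : k) (g : modOfEnd E T hT ⟶ modOfEnd E' T' hT') :
    modOfEnd.toLin (c • g) = c • modOfEnd.toLin g := by
  refine LinearMap.ext fun m => ?_
  exact (modOfEnd.equiv_mk_smul (Polynomial.C c) _).trans (by rw [Polynomial.aeval_C]; rfl)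

lemma modOfEnd.toLin_injective : Function.Injective
    (modOfEnd.toLin : (modOfEnd E T hT ⟶ modOfEnd E' T' hT') → (E →ₗ[k] E')) :=
  fun _ _ h => ModuleCat.hom_ext (LinearMap.ext fun m => LinearMap.congr_fun h m)

lemma modOfEnd.toLin_commute (g : modOfEnd E T hT ⟶ modOfEnd E' T' hT') (m : E) :
    modOfEnd.toLin g (T m) = T' (modOfEnd.toLin g m) := by
  have e : (modOfEnd.equiv T hT).symm (T m) =
      (Ideal.Quotient.mk _ Polynomial.X : TruncatedPolynomial k n) •
        (modOfEnd.equiv T hT).symm m := by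
    rw [AddEquiv.symm_apply_eq, modOfEnd.equiv_mk_smul, Polynomial.aeval_X,
      AddEquiv.apply_symm_apply]
  change modOfEnd.equiv T' hT' (g.hom _) = _
  rw [e, map_smul, modOfEnd.equiv_mk_smul, Polynomial.aeval_X]
  rfl

lemma modOfEnd.finite [Module.Finite k E] :
    Module.Finite (TruncatedPolynomial k n) (modOfEnd E T hT) := by
  obtain ⟨s, hs⟩ := Module.Finite.fg_top (R := k) (M := E)
  refine Module.finite_def.2 (Submodule.fg_def.2
    ⟨(modOfEnd.equiv T hT).symm '' s, s.finite_toSet.image _, top_le_iff.1 fun m _ => ?_⟩)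
  suffices h : ∀ m' : E, m' ∈ Submodule.span k (s : Set E) →
      (modOfEnd.equiv T hT).symm m' ∈ Submodule.span (TruncatedPolynomial k n)
        ((modOfEnd.equiv T hT).symm '' s) by
    have := h (modOfEnd.equiv T hT m) (hs ▸ Submodule.mem_top)
    rwa [AddEquiv.symm_apply_apply] at this
  intro m' hm'
  induction hm' using Submodule.span_induction with
  | mem x hx => exact Submodule.subset_span ⟨x, hx, rfl⟩
  | zero => rw [map_zero]; exact Submodule.zero_mem _
  | add x y _ _ hx hy => rw [map_add]; exact Submodule.add_mem _ hx hy
  | smul c x _ hx =>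
    have := Submodule.smul_mem _ (Ideal.Quotient.mk _ (Polynomial.C c)) hx
    convert this using 1
    rw [AddEquiv.symm_apply_eq, modOfEnd.equiv_mk_smul, Polynomial.aeval_C,
      AddEquiv.apply_symm_apply]
    rfl

end ModuleOfEnd

/-! ### Representations of the linear quiver from chains of maps -/

section LinearQuiver

/-- The functor from the path category of `1 → 2 → ⋯ → m` to the corresponding ordinal. -/
def pathsToFin (m : ℕ) : Paths (LinearQuiver m) ⥤ Fin m :=
  Paths.lift
    { obj := fun i => (i : Fin m)
      map := fun {i j} α => homOfLE (by
        have := α.down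
        exact Fin.le_def.2 (by omega)) }

variable {Λ : Type u} [Ring Λ]

/-- The representation of the linearly oriented quiver given by a chain of linear maps. -/
def ofChain (S : ComposableArrows (ModuleCat.{u} Λ) 3) : QuiverRep (LinearQuiver 4) Λ :=
  pathsToFin 4 ⋙ S

-- A vertex has at most one incoming arrow, so the direct sum has at most one summand.
open Classical in
lemma incoming_injective {m : ℕ} (M : QuiverRep (LinearQuiver m) Λ)
    (h : ∀ (i j : LinearQuiver m) (α : i ⟶ j), Function.Injective (M.along α))
    (j : LinearQuiver m) : Function.Injective (M.incoming j) := by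
  have : Subsingleton (Σ i : LinearQuiver m, (i ⟶ j)) := by
    constructor
    rintro ⟨i, ⟨hi⟩⟩ ⟨i', ⟨hi'⟩⟩
    have : i = i' := Fin.ext (by omega)
    subst this
    rfl
  rw [injective_iff_map_eq_zero]
  intro x hx
  ext α
  have e : x = DirectSum.lof Λ _ (fun α : (Σ i : LinearQuiver m, (i ⟶ j)) => M.at_ α.1) α
      (x α) := by
    ext β
    obtain rfl := Subsingleton.elim α β
    simp [DirectSum.lof_apply]
  have hx' : M.along α.2 (x α) = 0 := by
    rw [e, QuiverRep.incoming, DirectSum.toModule_lof] at hx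
    exact hx
  exact h _ _ α.2 (hx'.trans (map_zero _).symm)

end LinearQuiver

/-! ### Indecomposability through idempotents -/

section Idempotents

variable {C D : Type*} [Category* C] [Category* D] [Preadditive C] [Preadditive D]

lemma isZero_of_id_eq_zero {X : C} (h : 𝟙 X = 0) : IsZero X :=
  (IsZero.iff_id_eq_zero X).2 h

/-- In an idempotent complete category, an indecomposable object has no idempotent endomorphisms
except zero and the identity. -/
lemma idempotent_eq_zero_or_id [IsIdempotentComplete C] {X : C} (hX : IsIndecomposable X)
    (p : X ⟶ X) (hp : p ≫ p = p) : p = 0 ∨ p = 𝟙 X := by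
  have hq : (𝟙 X - p) ≫ (𝟙 X - p) = 𝟙 X - p := by simp [hp]
  -- Splitting both `p` and `𝟙 X - p` exhibits `X` as a biproduct; the cross terms vanish because
  -- the two idempotents are orthogonal.
  obtain ⟨Y, i, r, hir, hri⟩ := IsIdempotentComplete.idempotents_split X p hp
  obtain ⟨Z, j, s, hjs, hsj⟩ := IsIdempotentComplete.idempotents_split X _ hq
  have h₁ : i ≫ s = 0 := by
    have : i ≫ s = i ≫ p ≫ (𝟙 X - p) ≫ s := by
      rw [← hsj, ← hri]
      simp only [Category.assoc, reassoc_of% hir, hjs, Category.comp_id]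
    rw [this, ← Category.assoc p]
    simp [hp]
  have h₂ : j ≫ r = 0 := by
    have : j ≫ r = j ≫ (𝟙 X - p) ≫ p ≫ r := by
      rw [← hsj, ← hri]
      simp only [Category.assoc, reassoc_of% hjs, hir, Category.comp_id]
    rw [this, ← Category.assoc (𝟙 X - p)]
    simp [hp]
  let b : BinaryBicone Y Z :=
    { pt := X, fst := r, snd := s, inl := i, inr := j
      inl_fst := hir, inl_snd := h₁, inr_fst := h₂, inr_snd := hjs }
  have hb : b.IsBilimit := isBinaryBilimitOfTotal b (by
    change r ≫ i + s ≫ j = 𝟙 X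
    rw [hri, hsj]
    abel)
  rcases hX.2 Y Z b ⟨hb⟩ ⟨Iso.refl X⟩ with h | h
  · left
    rw [← hri, h.eq_of_src i 0, comp_zero]
  · right
    have : 𝟙 X - p = 0 := by rw [← hsj, h.eq_of_src j 0, comp_zero]
    exact (sub_eq_zero.1 this).symm

/-- A functor whose maps on morphisms have functorial additive retractions that kill no nonzero
idempotent preserves indecomposable objects. -/
lemma isIndecomposable_map [IsIdempotentComplete C] (F : C ⥤ D)
    (G : ∀ {X Y : C}, (F.obj X ⟶ F.obj Y) → (X ⟶ Y))
    (hGF : ∀ {X Y : C} (h : X ⟶ Y), G (F.map h) = h)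
    (hG_comp : ∀ {X Y Z : C} (f : F.obj X ⟶ F.obj Y) (g : F.obj Y ⟶ F.obj Z),
      G (f ≫ g) = G f ≫ G g)
    (hG_add : ∀ {X Y : C} (f g : F.obj X ⟶ F.obj Y), G (f + g) = G f + G g)
    (hG_idem : ∀ {X : C} (e : F.obj X ⟶ F.obj X), e ≫ e = e → G e = 0 → e = 0)
    {X : C} (hX : IsIndecomposable X) : IsIndecomposable (F.obj X) := by
  have hG_id : G (𝟙 (F.obj X)) = 𝟙 X := by rw [← F.map_id, hGF]
  have hG_zero : G (0 : F.obj X ⟶ F.obj X) = 0 := by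
    have := hG_add (0 : F.obj X ⟶ F.obj X) 0
    simpa using this
  refine ⟨fun h => hX.1 (isZero_of_id_eq_zero ?_), ?_⟩
  · rw [← hG_id, h.eq_of_src (𝟙 _) 0, hG_zero]
  · rintro Y Z b ⟨hb⟩ ⟨φ⟩
    have htot : b.fst ≫ b.inl + b.snd ≫ b.inr = 𝟙 b.pt := IsBilimit.binary_total hb
    have idem {W : D} (i : W ⟶ b.pt) (r : b.pt ⟶ W) (h : i ≫ r = 𝟙 W) :
        (φ.hom ≫ (r ≫ i) ≫ φ.inv) ≫ φ.hom ≫ (r ≫ i) ≫ φ.inv = φ.hom ≫ (r ≫ i) ≫ φ.inv := by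
      simp [reassoc_of% h]
    have zero {W : D} (i : W ⟶ b.pt) (r : b.pt ⟶ W) (h : i ≫ r = 𝟙 W)
        (h0 : φ.hom ≫ (r ≫ i) ≫ φ.inv = 0) : IsZero W := by
      apply isZero_of_id_eq_zero
      have e : 𝟙 W = i ≫ φ.inv ≫ (φ.hom ≫ (r ≫ i) ≫ φ.inv) ≫ φ.hom ≫ r := by
        simp [h]
      rw [e, h0]
      simp
    have hp := idem b.inl b.fst b.inl_fst
    have hq := idem b.inr b.snd b.inr_snd
    have hsum : φ.hom ≫ (b.fst ≫ b.inl) ≫ φ.inv + φ.hom ≫ (b.snd ≫ b.inr) ≫ φ.inv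
        = 𝟙 (F.obj X) := by
      rw [← Preadditive.comp_add, ← Preadditive.add_comp, htot]
      simp
    have hGsum := hG_add (φ.hom ≫ (b.fst ≫ b.inl) ≫ φ.inv) (φ.hom ≫ (b.snd ≫ b.inr) ≫ φ.inv)
    rw [hsum, hG_id] at hGsum
    -- Only the source category needs split idempotents: `G` carries the two complementary
    -- projections to idempotents of `X` with sum `𝟙 X`, so one of them becomes zero.
    rcases idempotent_eq_zero_or_id hX (G (φ.hom ≫ (b.fst ≫ b.inl) ≫ φ.inv))
      (by rw [← hG_comp, hp]) with h | h
    · exact Or.inl (zero _ _ b.inl_fst (hG_idem _ hp h))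
    · refine Or.inr (zero _ _ b.inr_snd (hG_idem _ hq ?_))
      rw [h] at hGsum
      exact left_eq_add.1 hGsum

end Idempotents

/-! ### Pointwise short exactness -/

section FunctorCategory

/-- A short complex of functors is short exact if it is so at every object. -/
lemma shortExact_of_evaluation {J A : Type*} [Category* J] [Category* A] [Abelian A]
    (S : ShortComplex (J ⥤ A)) (h : ∀ j, (S.map ((evaluation J A).obj j)).ShortExact) :
    S.ShortExact where
  exact := by
    rw [ShortComplex.exact_iff_isZero_homology, Functor.isZero_iff]
    intro j
    exact ((ShortComplex.exact_iff_isZero_homology _).1 (h j).exact).of_iso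
      (S.mapHomologyIso ((evaluation J A).obj j)).symm
  mono_f := by
    have : ∀ j, Mono (S.f.app j) := fun j => (h j).mono_f
    exact NatTrans.mono_of_mono_app _
  epi_g := by
    have : ∀ j, Epi (S.g.app j) := fun j => (h j).epi_g
    exact NatTrans.epi_of_epi_app _

end FunctorCategory

/-! ### Representations of the two-loop quiver as pairs of operators -/

section TwoLoops

variable {k : Type u} [Field k]

/-- The vector space of a representation of the quiver with two loops. -/
abbrev space (X : QuiverRep TwoLoopQuiver k) : Type u := X.at_ (Quiver.SingleObj.star (Fin 2))

/-- The operators of a representation of the quiver with two loops. -/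
abbrev loop (X : QuiverRep TwoLoopQuiver k) (i : Fin 2) : space X →ₗ[k] space X :=
  X.along (Quiver.SingleObj.toHom i)

/-- The linear map of vector spaces given by a morphism of representations. -/
abbrev spaceMap {X Y : QuiverRep TwoLoopQuiver k} (h : X ⟶ Y) : space X →ₗ[k] space Y :=
  (h.app ((Paths.of TwoLoopQuiver).obj (Quiver.SingleObj.star (Fin 2)))).hom

lemma spaceMap_loop {X Y : QuiverRep TwoLoopQuiver k} (h : X ⟶ Y) (i : Fin 2) (v : space X) :
    spaceMap h (loop X i v) = loop Y i (spaceMap h v) :=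
  LinearMap.congr_fun (congrArg ModuleCat.Hom.hom
    (h.naturality ((Paths.of TwoLoopQuiver).map (Quiver.SingleObj.toHom i)))) v

/-- The morphism of representations given by a linear map which commutes with the operators. -/
def repHom {X Y : QuiverRep TwoLoopQuiver k} (p : space X →ₗ[k] space Y)
    (hp : ∀ i v, p (loop X i v) = loop Y i (p v)) : X ⟶ Y where
  app _ := ModuleCat.ofHom p
  naturality := by
    intro a b f
    induction f using Paths.induction with
    | id =>
      rw [X.map_id, Y.map_id]
      rfl
    | comp q i hq =>
      rw [X.map_comp, Y.map_comp, Category.assoc]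
      have : X.map ((Paths.of TwoLoopQuiver).map i) ≫ ModuleCat.ofHom p =
          ModuleCat.ofHom p ≫ Y.map ((Paths.of TwoLoopQuiver).map i) :=
        ModuleCat.hom_ext (LinearMap.ext (hp i))
      rw [← Category.assoc (ModuleCat.ofHom p), ← hq, Category.assoc]
      exact congrArg (X.map q ≫ ·) this

lemma repHom_ext {X Y : QuiverRep TwoLoopQuiver k} {f g : X ⟶ Y} (h : spaceMap f = spaceMap g) :
    f = g := by
  ext1
  funext a
  exact ModuleCat.hom_ext h

/-- Split in the ambient abelian category; the image is a quotient of a finite-dimensional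
representation. -/
instance : IsIdempotentComplete (repFg TwoLoopQuiver k).FullSubcategory where
  idempotents_split X p hp := by
    obtain ⟨Y, i, r, h₁, h₂⟩ :=
      IsIdempotentComplete.idempotents_split X.obj p.hom (congrArg InducedCategory.Hom.hom hp)
    have hY : repFg TwoLoopQuiver k Y := fun a => by
      have := X.property a
      refine Module.Finite.of_surjective (r.app ((Paths.of _).obj a)).hom fun y => ?_
      exact ⟨(i.app ((Paths.of _).obj a)).hom y, LinearMap.congr_fun
        (congrArg ModuleCat.Hom.hom (NatTrans.congr_app h₁ ((Paths.of _).obj a))) y⟩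
    exact ⟨⟨Y, hY⟩, ObjectProperty.homMk i, ObjectProperty.homMk r,
      ObjectProperty.hom_ext _ h₁, ObjectProperty.hom_ext _ h₂⟩

end TwoLoops

/-! ### The chain attached to a pair of operators, and its morphisms -/

section Chain

variable {k : Type u} [Field k] {V V' : Type u} [AddCommGroup V] [Module k V]
  [AddCommGroup V'] [Module k V']

/-- The chain of monomorphisms of `k[x]/(x^4)`-modules given by a vector space with two
operators. -/
noncomputable def chain (A B : V →ₗ[k] V) :
    ComposableArrows (ModuleCat.{u} (TruncatedPolynomial k 4)) 3 :=
  ComposableArrows.mk₃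
    -- `x` acts as zero because `incl₁` lands in degree `2`, which `shift₂` kills.
    (X₀ := modOfEnd V (0 : Module.End k V) (zero_pow (by norm_num)))
    (X₁ := modOfEnd (Space₂ V) (shift₂ : Module.End k (Space₂ V)) shift₂_pow)
    (X₂ := modOfEnd (Space₃ V) (shift₃ A : Module.End k (Space₃ V)) (shift₃_pow A))
    (X₃ := modOfEnd (Space₄ V) (shift₄ A : Module.End k (Space₄ V)) (shift₄_pow A))
    (modOfEnd.ofLin (incl₁ B) (incl₁_shift B)) (modOfEnd.ofLin incl₂ (incl₂_shift A))
    (modOfEnd.ofLin incl₃ (incl₃_shift A))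

/-- The morphism of chains given by a linear map which commutes with the operators. -/
noncomputable def chainMap {A B : V →ₗ[k] V} {A' B' : V' →ₗ[k] V'} (h : V →ₗ[k] V')
    (hA : ∀ v, h (A v) = A' (h v)) (hB : ∀ v, h (B v) = B' (h v)) : chain A B ⟶ chain A' B' :=
  ComposableArrows.homMk₃
    (modOfEnd.ofLin h (by simp))
    (modOfEnd.ofLin (diag₂ h) (by simp))
    (modOfEnd.ofLin (diag₃ h) (by simp [hA]))
    (modOfEnd.ofLin (diag₄ h) (by simp [hA]))
    (modOfEnd.toLin_injective (LinearMap.ext fun v => by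
      change diag₂ h (incl₁ B v) = incl₁ B' (h v)
      simp [hB]))
    (modOfEnd.toLin_injective (LinearMap.ext fun v => by
      change diag₃ h (incl₂ (k := k) v) = incl₂ (k := k) (diag₂ h v)
      simp))
    (modOfEnd.toLin_injective (LinearMap.ext fun v => by
      change diag₄ h (incl₃ (k := k) v) = incl₃ (k := k) (diag₃ h v)
      simp))

lemma monoCat_chain [Module.Finite k V] (A B : V →ₗ[k] V) :
    monoCat (LinearQuiver 4) (TruncatedPolynomial k 4) (ofChain (chain A B)) := by
  refine ⟨?_, incoming_injective _ ?_⟩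
  · rintro ⟨i, hi⟩
    interval_cases i
    · exact modOfEnd.finite (E := V)
    · exact modOfEnd.finite (E := Space₂ V)
    · exact modOfEnd.finite (E := Space₃ V)
    · exact modOfEnd.finite (E := Space₄ V)
  · rintro ⟨i, hi⟩ ⟨j, hj⟩ ⟨hij : i + 1 = j⟩
    subst hij
    have : i < 3 := by omega
    interval_cases i
    · exact incl₁_injective B
    · exact incl₂_injective (k := k)
    · exact incl₃_injective (k := k)

variable {A B : V →ₗ[k] V} {A' B' : V' →ₗ[k] V'}

/-- The component at the first vertex. -/
noncomputable def component₁ (φ : ofChain (chain A B) ⟶ ofChain (chain A' B')) : V →ₗ[k] V' :=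
  modOfEnd.toLin (φ.app ((0 : Fin 4) :))

/-- The component at the second vertex. -/
noncomputable def component₂ (φ : ofChain (chain A B) ⟶ ofChain (chain A' B')) :
    Space₂ V →ₗ[k] Space₂ V' :=
  modOfEnd.toLin (φ.app ((1 : Fin 4) :))

/-- The component at the third vertex. -/
noncomputable def component₃ (φ : ofChain (chain A B) ⟶ ofChain (chain A' B')) :
    Space₃ V →ₗ[k] Space₃ V' :=
  modOfEnd.toLin (φ.app ((2 : Fin 4) :))

/-- The component at the last vertex. -/
noncomputable def component₄ (φ : ofChain (chain A B) ⟶ ofChain (chain A' B')) :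
    Space₄ V →ₗ[k] Space₄ V' :=
  modOfEnd.toLin (φ.app ((3 : Fin 4) :))

/-- The arrow from a vertex to the next one. -/
abbrev nextArrow (i : ℕ) (hi : i + 1 < 4) :
    (Paths.of (LinearQuiver 4)).obj (⟨i, by omega⟩ : Fin 4) ⟶
      (Paths.of (LinearQuiver 4)).obj (⟨i + 1, hi⟩ : Fin 4) :=
  (Paths.of (LinearQuiver 4)).map ⟨rfl⟩

lemma isChainMap (φ : ofChain (chain A B) ⟶ ofChain (chain A' B')) :
    IsChainMap A B A' B' (component₁ φ) (component₂ φ) (component₃ φ) (component₄ φ) where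
  shift m := modOfEnd.toLin_commute _ m
  incl₁ v := LinearMap.congr_fun (congrArg ModuleCat.Hom.hom
    (φ.naturality (nextArrow 0 (by norm_num)))) v
  incl₂ v := LinearMap.congr_fun (congrArg ModuleCat.Hom.hom
    (φ.naturality (nextArrow 1 (by norm_num)))) v
  incl₃ v := LinearMap.congr_fun (congrArg ModuleCat.Hom.hom
    (φ.naturality (nextArrow 2 (by norm_num)))) v

lemma ofChain_hom_ext {φ ψ : ofChain (chain A B) ⟶ ofChain (chain A' B')}
    (h₁ : component₁ φ = component₁ ψ) (h₂ : component₂ φ = component₂ ψ)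
    (h₃ : component₃ φ = component₃ ψ) (h₄ : component₄ φ = component₄ ψ) : φ = ψ := by
  ext1
  funext ⟨i, hi⟩
  interval_cases i
  · exact modOfEnd.toLin_injective h₁
  · exact modOfEnd.toLin_injective h₂
  · exact modOfEnd.toLin_injective h₃
  · exact modOfEnd.toLin_injective h₄

/-- An idempotent endomorphism whose component at the first vertex vanishes is zero. -/
lemma eq_zero_of_component₁_eq_zero (φ : ofChain (chain A B) ⟶ ofChain (chain A B))
    (hφ : φ ≫ φ = φ) (h : component₁ φ = 0) : φ = 0 := by
  have hc := isChainMap φ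
  rw [h] at hc
  have h₄ : component₄ φ = 0 := hc.eq_zero_of_idempotent fun m => LinearMap.congr_fun
    (congrArg component₄ hφ) m
  -- Vanishing at the last vertex descends along the injective inclusions.
  have h₃ : component₃ φ = 0 := LinearMap.ext fun m => incl₃_injective (k := k) (by
    rw [← hc.incl₃, h₄]
    exact (map_zero _).symm)
  have h₂ : component₂ φ = 0 := LinearMap.ext fun m => incl₂_injective (k := k) (by
    rw [← hc.incl₂, h₃]
    exact (map_zero _).symm)
  exact ofChain_hom_ext h h₂ h₃ h₄

end Chain

/-! ### The functor and its retraction on morphisms -/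

section Functor

variable (k : Type u) [Field k]

/-- The functor from representations of the quiver with two loops to chains of monomorphisms. -/
noncomputable def wildFunctor : (repFg TwoLoopQuiver k).FullSubcategory ⥤
    (monoCat (LinearQuiver 4) (TruncatedPolynomial k 4)).FullSubcategory where
  obj X := ⟨ofChain (chain (loop X.obj 0) (loop X.obj 1)),
    have : Module.Finite k (space X.obj) := X.property _
    monoCat_chain _ _⟩
  map h := ObjectProperty.homMk (Functor.whiskerLeft (pathsToFin 4)
    (chainMap (spaceMap h.hom) (spaceMap_loop h.hom 0) (spaceMap_loop h.hom 1)))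
  map_id X := by
    apply ObjectProperty.hom_ext
    apply ofChain_hom_ext <;> rfl
  map_comp f g := by
    apply ObjectProperty.hom_ext
    apply ofChain_hom_ext <;> rfl

variable {k}

lemma wildFunctor_map_ext {X Y : (repFg TwoLoopQuiver k).FullSubcategory}
    (φ : (wildFunctor k).obj X ⟶ (wildFunctor k).obj Y) (h : X ⟶ Y)
    (h₁ : component₁ φ.hom = spaceMap h.hom)
    (h₂ : component₂ φ.hom = diag₂ (spaceMap h.hom))
    (h₃ : component₃ φ.hom = diag₃ (spaceMap h.hom))
    (h₄ : component₄ φ.hom = diag₄ (spaceMap h.hom)) : (wildFunctor k).map h = φ :=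
  ObjectProperty.hom_ext _ (ofChain_hom_ext h₁.symm h₂.symm h₃.symm h₄.symm)

/-- The restriction of a morphism to the first vertex, as a morphism of representations. -/
noncomputable def restrict {X Y : (repFg TwoLoopQuiver k).FullSubcategory}
    (φ : (wildFunctor k).obj X ⟶ (wildFunctor k).obj Y) : X ⟶ Y :=
  ObjectProperty.homMk (repHom (component₁ φ.hom) fun i => by
    -- Compatibility with the loops is not naturality at the first vertex, where `x` acts as zero;
    -- it comes from rigidity.
    have h := (isChainMap φ.hom).rigidity.2
    fin_cases i
    · exact h.1
    · exact h.2)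

lemma restrict_map {X Y : (repFg TwoLoopQuiver k).FullSubcategory} (h : X ⟶ Y) :
    restrict ((wildFunctor k).map h) = h :=
  ObjectProperty.hom_ext _ (repHom_ext rfl)

lemma restrict_comp {X Y Z : (repFg TwoLoopQuiver k).FullSubcategory}
    (φ : (wildFunctor k).obj X ⟶ (wildFunctor k).obj Y)
    (ψ : (wildFunctor k).obj Y ⟶ (wildFunctor k).obj Z) :
    restrict (φ ≫ ψ) = restrict φ ≫ restrict ψ :=
  ObjectProperty.hom_ext _ (repHom_ext rfl)

lemma restrict_add {X Y : (repFg TwoLoopQuiver k).FullSubcategory}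
    (φ ψ : (wildFunctor k).obj X ⟶ (wildFunctor k).obj Y) :
    restrict (φ + ψ) = restrict φ + restrict ψ :=
  ObjectProperty.hom_ext _ (repHom_ext rfl)

lemma eq_zero_of_restrict_eq_zero {X : (repFg TwoLoopQuiver k).FullSubcategory}
    (φ : (wildFunctor k).obj X ⟶ (wildFunctor k).obj X) (hφ : φ ≫ φ = φ)
    (h : restrict φ = 0) : φ = 0 :=
  ObjectProperty.hom_ext _ (eq_zero_of_component₁_eq_zero φ.hom
    (congrArg InducedCategory.Hom.hom hφ) (congrArg (fun f => spaceMap f.hom) h))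

instance : (wildFunctor k).Additive where
  map_add := wildFunctor_map_ext _ _ rfl rfl rfl rfl

instance : (wildFunctor k).Linear k where
  map_smul {X Y} f c := by
    apply wildFunctor_map_ext
    · exact modOfEnd.toLin_smul c _
    · exact modOfEnd.toLin_smul c _
    · exact modOfEnd.toLin_smul c _
    · exact modOfEnd.toLin_smul c _

instance : (wildFunctor k).Faithful where
  map_injective {X Y f g} h := by rw [← restrict_map f, h, restrict_map]

/-- At each vertex the functor is a finite power of the underlying space, with morphisms acting
diagonally, so exactness is inherited vertex by vertex. -/
lemma wildFunctor_exact : IsExactBetween (wildFunctor k) := by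
  intro S hS
  have hS' := hS.map_of_exact ((evaluation _ _).obj
    ((Paths.of TwoLoopQuiver).obj (Quiver.SingleObj.star (Fin 2))))
  have hi : Function.Injective (spaceMap S.f.hom) := hS'.moduleCat_injective_f
  have hs : Function.Surjective (spaceMap S.g.hom) := hS'.moduleCat_surjective_g
  have he : Function.Exact (spaceMap S.f.hom) (spaceMap S.g.hom) :=
    (ShortComplex.ShortExact.moduleCat_exact_iff_function_exact _).1 hS'.exact
  have i₂ := hi.prodMap hi
  have i₃ := hi.prodMap i₂
  have i₄ := hi.prodMap i₃
  have s₂ := hs.prodMap hs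
  have s₃ := hs.prodMap s₂
  have s₄ := hs.prodMap s₃
  have e₂ := exact_prodMap he he
  have e₃ := exact_prodMap he e₂
  have e₄ := exact_prodMap he e₃
  apply shortExact_of_evaluation
  rintro ⟨i, hi'⟩
  interval_cases i
  · exact ModuleCat.shortComplex_shortExact _ he hi hs
  · exact ModuleCat.shortComplex_shortExact _ (exact_prodMap e₂ e₃) (i₂.prodMap i₃) (s₂.prodMap s₃)
  · exact ModuleCat.shortComplex_shortExact _ (exact_prodMap e₂ (exact_prodMap e₄ e₃))
      (i₂.prodMap (i₄.prodMap i₃)) (s₂.prodMap (s₄.prodMap s₃))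
  · exact ModuleCat.shortComplex_shortExact _
      (exact_prodMap e₂ (exact_prodMap e₄ (exact_prodMap e₄ e₃)))
      (i₂.prodMap (i₄.prodMap (i₄.prodMap i₃))) (s₂.prodMap (s₄.prodMap (s₄.prodMap s₃)))

end Functor

end WildMono

theorem theorem4p1 (k : Type u) [Field k] :
    IsWild k (monoCat (LinearQuiver 4) (TruncatedPolynomial k 4)) := by
  refine ⟨WildMono.wildFunctor k, inferInstance, inferInstance, inferInstance,
    WildMono.wildFunctor_exact, fun X hX => ?_, fun X Y ⟨φ⟩ =>
      ⟨⟨WildMono.restrict φ.hom, WildMono.restrict φ.inv, ?_, ?_⟩⟩⟩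
  · exact WildMono.isIndecomposable_map (WildMono.wildFunctor k) WildMono.restrict
      WildMono.restrict_map WildMono.restrict_comp WildMono.restrict_add
      WildMono.eq_zero_of_restrict_eq_zero hX
  · rw [← WildMono.restrict_comp, φ.hom_inv_id, ← (WildMono.wildFunctor k).map_id,
      WildMono.restrict_map]
  · rw [← WildMono.restrict_comp, φ.inv_hom_id, ← (WildMono.wildFunctor k).map_id,
      WildMono.restrict_map]
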